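/- **Setting.** Let $X$ be a set of instances, $(x_1,y_1),\dots,(x_m,y_m)\in X\times\{-1,1\}$ a fixed labelled sample, and $\mathcal H$ a (finite or infinite) set of hypotheses $h:X\to\{-1,1\}$. The error row of $h$ is the vector $\eta\in\{0,1\}^m$ with $\eta(i)=\mathbf 1[h(x_i)\ne y_i]$; let $M$ be the finite set of error rows of the elements of $\mathcal H$, and for $\eta\in M$ let $H(\eta)\subseteq\mathcal H$ be the set of hypotheses with error row $\eta$ (its dichotomy class). Let $\Delta_m=\{w\in\mathbb R^m: w\ge 0,\ \sum_i w(i)=1\}$ and $\sigma_0=\{w\in\Delta_m:\eta\cdot w>0\text{ for all }\eta\in M\}$. Fix a tie-breaking rule that selects an element of each nonempty subset of $M$; let $\eta^w$ be the row selected from $\arg\min_{\eta\in M}\eta\cdot w$, let $\sigma^*(\eta)=\{w\in\Delta_m:\eta^w=\eta\}$ and $\sigma(\eta)=\{w\in\Delta_m:\eta\in\arg\min_{\eta'\in M}\eta'\cdot w\}$, and put $\epsilon(w)=\min_{\eta\in M}\eta\cdot w$ and $\alpha(w)=\frac12\log\frac{1-\epsilon(w)}{\epsilon(w)}$. The Optimal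 AdaBoost weight update is $$\mathcal A(w)_i=\tfrac12\,w(i)\Big(\frac1{\eta^w\cdot w}\Big)^{\eta^w(i)}\Big(\frac1{1-\eta^w\cdot w}\Big)^{1-\eta^w(i)},$$ which is defined on $\sigma_0$. Assume: 1. (Weak learning) there is $\gamma>0$ such that $\epsilon(w)<\frac12-\gamma$ for all $w\in\Delta_m$; then $\mathcal A$ maps $\sigma_0$ into itself. 2. (Eventually no ties) with $\Omega_\infty=\bigcap_{t\ge1}\mathcal A^{t}(\sigma_0)$, there is a compact $G\subseteq\Delta_m$ with $\Omega_\infty\subseteq G$ such that for all $\eta,\eta'\in M$ either $\sigma(\eta)\cap\sigma(\eta')\cap G=\emptyset$, or $\sum_{i:\eta(i)\ne\eta'(i)}w(i)=0$ for all $w\in G$. For an initial weight $w_1\in\sigma_0$ let $w_t=\mathcal A^{t-1}(w_1)$ and $C_\eta(T)=\sum_{t=1}^T\alpha(w_t)\mathbf 1[w_t\in\sigma^*(\eta)]$. **Theorem.** Suppose that the weak learner has a fixed representative $h^\eta\in H(\eta)$ for each $\eta\in M$ and returns $h_t=h^{\eta^{w_t}}$ in every round $t$, and let $F_T(x)=\sum_{t=1}^T\alpha(w_t)h_t(x)$.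 If $\Omega_\infty\neq\emptyset$, then there is an $\mathcal A$-invariant Borel probability measure on $\sigma_0$. For every $\mathcal A$-invariant Borel probability measure $\mu$ on $\sigma_0$ and $\mu$-almost every initial weight $w_1$, the limits $C^*_\eta=\lim_{T\to\infty}\frac1T C_\eta(T)$ exist in $\mathbb R$ for all $\eta\in M$, and for every instance $x\in X$ (not only in the sample) $$\lim_{T\to\infty}\frac1T F_T(x)=\sum_{\eta\in M}C^*_\eta\,h^\eta(x).$$ -/

import Mathlib

open Filter Topology MeasureTheory

noncomputable section

namespace OptimalAdaBoost

/-- A 0-1 row over the `m` training examples; `true` (that is, 1) marks a mistake. -/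
abbrev Row (m : ℕ) := Fin m → Bool

/-- The dot product `η · w`, i.e. the weighted error of the row `η`. -/
def Row.err {m : ℕ} (η : Row m) (w : Fin m → ℝ) : ℝ :=
  ∑ i, if η i = true then w i else 0

/-! ### From hypotheses to the error matrix

Labels and hypotheses take their values in `{-1, 1}`, which is the type `ℤˣ`. -/

section Sample

variable {X : Type*} {m : ℕ}

/-- The error row of a hypothesis `h` on the sample `(x 0, y 0), …, (x (m-1), y (m-1))`.  As the
labels are fixed, two hypotheses have the same error row iff they induce the same dichotomy. -/
def errRow (x : Fin m → X) (y : Fin m → ℤˣ) (h : X → ℤˣ) : Row m :=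
  fun i => decide (h (x i) ≠ y i)

open Classical in
/-- The error matrix `M` of the hypothesis space `H`, as the (finite) set of its rows. -/
def errMatrix (x : Fin m → X) (y : Fin m → ℤˣ) (H : Set (X → ℤˣ)) : Finset (Row m) :=
  Finset.univ.filter fun η => ∃ h ∈ H, errRow x y h = η

/-- The dichotomy class `H(η)`: the hypotheses whose error row is `η`. -/
def dichClass (x : Fin m → X) (y : Fin m → ℤˣ) (H : Set (X → ℤˣ)) (η : Row m) :
    Set (X → ℤˣ) :=
  {h | h ∈ H ∧ errRow x y h = η}

/-- The weak-learning assumption: some edge `γ > 0` is available for all example weights. -/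
def WeakLearning (M : Finset (Row m)) : Prop :=
  ∃ γ : ℝ, 0 < γ ∧ ∀ w ∈ stdSimplex ℝ (Fin m), ∃ η ∈ M, η.err w < 1 / 2 - γ

end Sample

/-! ### Optimal AdaBoost as a dynamical system of the example weights -/

section Dynamics

variable {m : ℕ}

/-- The rows of least weighted error. -/
def argminRows (M : Finset (Row m)) (w : Fin m → ℝ) : Finset (Row m) :=
  M.filter fun η => ∀ η' ∈ M, η.err w ≤ η'.err w

/-- `sel` is a tie-breaking rule on the set of rows `M`: it picks an element of each nonempty
subset of `M`. -/
def IsTieBreaker (M : Finset (Row m)) (sel : Finset (Row m) → Row m) : Prop :=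
  ∀ A : Finset (Row m), A ⊆ M → A.Nonempty → sel A ∈ A

/-- The best row `η^w`. -/
def best (M : Finset (Row m)) (sel : Finset (Row m) → Row m) (w : Fin m → ℝ) : Row m :=
  sel (argminRows M w)

/-- The region `σ*(η)` of weights at which `η` is selected. -/
def sigmaStar (M : Finset (Row m)) (sel : Finset (Row m) → Row m) (η : Row m) :
    Set (Fin m → ℝ) :=
  {w | w ∈ stdSimplex ℝ (Fin m) ∧ η = best M sel w}

/-- The region `σ(η)` of weights at which `η` is among the best rows. -/
def sigma (M : Finset (Row m)) (η : Row m) : Set (Fin m → ℝ) :=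
  {w | w ∈ stdSimplex ℝ (Fin m) ∧ η ∈ argminRows M w}

/-- The set `σ₀` of weights at which every row has positive error. -/
def sigmaZero (M : Finset (Row m)) : Set (Fin m → ℝ) :=
  {w | w ∈ stdSimplex ℝ (Fin m) ∧ ∀ η ∈ M, 0 < η.err w}

/-- The hypothetical weight update `𝒯_η`. -/
def hypUpdate (η : Row m) (w : Fin m → ℝ) : Fin m → ℝ :=
  fun i => if η i = true then 1 / 2 * w i * (1 / η.err w) else 1 / 2 * w i * (1 / (1 - η.err w))

/-- The AdaBoost weight update `𝒜`.  Within the simplex it is meaningful exactly on `σ₀` (off `σ₀`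
the best row has error zero and `𝒯_η` divides by zero); under weak learning it maps `σ₀` into
itself. -/
def update (M : Finset (Row m)) (sel : Finset (Row m) → Row m) (w : Fin m → ℝ) : Fin m → ℝ :=
  hypUpdate (best M sel w) w

/-- The least error `ε(w)` (a minimum, as `M` is finite and, in use, nonempty). -/
def minErr (M : Finset (Row m)) (w : Fin m → ℝ) : ℝ :=
  sInf ((fun η : Row m => η.err w) '' (M : Set (Row m)))

/-- The coefficient `α(w)`. -/
def alpha (M : Finset (Row m)) (w : Fin m → ℝ) : ℝ :=
  1 / 2 * Real.log ((1 - minErr M w) / minErr M w)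

/-- The weights at round `t + 1` of the run started at `w₁` (rounds are numbered from 1). -/
def weights (M : Finset (Row m)) (sel : Finset (Row m) → Row m) (w₁ : Fin m → ℝ) (t : ℕ) :
    Fin m → ℝ :=
  (update M sel)^[t] w₁

/-- The set `Ω_∞` of states that can be reached after any number of rounds, `𝒜` being iterated
on its domain `σ₀`. -/
def omegaInf (M : Finset (Row m)) (sel : Finset (Row m) → Row m) : Set (Fin m → ℝ) :=
  ⋂ t : ℕ, ⋂ _ : 1 ≤ t, (update M sel)^[t] '' sigmaZero M

/-- Optimal AdaBoost eventually has no ties. -/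
def EventuallyNoTies (M : Finset (Row m)) (sel : Finset (Row m) → Row m) : Prop :=
  ∃ G : Set (Fin m → ℝ), G ⊆ stdSimplex ℝ (Fin m) ∧ IsCompact G ∧ omegaInf M sel ⊆ G ∧
    ∀ η ∈ M, ∀ η' ∈ M,
      sigma M η ∩ sigma M η' ∩ G = ∅ ∨
      ∀ w ∈ G, ∑ i, (if η i ≠ η' i then w i else 0) = 0

/-- `μ` is a Borel probability measure on the weights that makes `𝒜` a measure-preserving
dynamical system.  It has to live on the domain `σ₀` of `𝒜`. -/
def IsInvariantProbability (M : Finset (Row m)) (sel : Finset (Row m) → Row m)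
    (μ : Measure (Fin m → ℝ)) : Prop :=
  IsProbabilityMeasure μ ∧ (∀ᵐ w ∂μ, w ∈ sigmaZero M) ∧ MeasurePreserving (update M sel) μ μ

/-- `C_η(T)`: the total coefficient that the row `η` receives in rounds `1, …, T`. -/
def rowCoeff (M : Finset (Row m)) (sel : Finset (Row m) → Row m) (w₁ : Fin m → ℝ) (η : Row m)
    (T : ℕ) : ℝ :=
  ∑ t ∈ Finset.range T,
    alpha M (weights M sel w₁ t) *
      (sigmaStar M sel η).indicator (fun _ => (1 : ℝ)) (weights M sel w₁ t)

/-- `F_T(x)`, the sum of `α_t h_t(x)` over the rounds `1, …, T`, where `h t` is the hypothesis in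
`{-1, 1}^X` that the weak learner returned in round `t + 1`. -/
def score {X : Type*} (M : Finset (Row m)) (sel : Finset (Row m) → Row m) (w₁ : Fin m → ℝ)
    (h : ℕ → X → ℤˣ) (T : ℕ) (x : X) : ℝ :=
  ∑ t ∈ Finset.range T, alpha M (weights M sel w₁ t) * ((h t x : ℤ) : ℝ)

/-- The weak learner always picks the fixed representative `rep η` of the class of the best row. -/
def PicksRepresentatives {X : Type*} (M : Finset (Row m)) (sel : Finset (Row m) → Row m)
    (rep : Row m → X → ℤˣ) (w₁ : Fin m → ℝ) (h : ℕ → X → ℤˣ) : Prop :=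
  ∀ t, h t = rep (best M sel (weights M sel w₁ t))

end Dynamics

end OptimalAdaBoost

end

/-! In every round exactly one row is selected, so $F_T(x)=\sum_\eta C_\eta(T)\,h^\eta(x)$ holds
exactly, for every $T$ and $x$. Everything therefore reduces to the averages of $C_\eta(T)$, which
are Birkhoff averages of $\alpha\cdot\mathbf 1_{\sigma^*(\eta)}$ under $\mathcal A$.

The obstacle is that $\alpha$ is unbounded where the least error tends to 0. The potential
$\varphi(w)=\sum_{\eta\in M}\log(\eta\cdot w)\le 0$ controls it. One update raises the error of the
selected row from $\epsilon$ to $1/2$ and at worst halves every other error, so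
$\alpha\le-\log\epsilon\le\varphi\circ\mathcal A-\varphi+|M|\log 2$ (`neg_log_err_best_le`).

This inequality is used twice. Integrated against an invariant measure it makes $\alpha$ integrable
(`lintegral_coboundary_add_const_lt_top`), and the pointwise ergodic theorem applies. Summed along
an orbit it bounds the averages of $-\log\epsilon$, so the empirical measures are tight in
$\sigma_0$. On the closure of an orbit in $\Omega_\infty$ the no-ties condition makes $\mathcal A$
continuous at the points of $\sigma_0$, and the Krylov–Bogolyubov argument gives an invariant
measure. -/

open Filter Topology MeasureTheory

noncomputable section
namespace OptimalAdaBoost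

/-! ### The pointwise ergodic theorem -/

section Birkhoff

variable {Ω : Type*}

/-- The running maximum `max_{0 ≤ k ≤ n} S_k g` of the Birkhoff sums. -/
def maxBirkhoffSum (T : Ω → Ω) (g : Ω → ℝ) : ℕ → Ω → ℝ
  | 0, _ => 0
  | n + 1, x => max 0 (g x + maxBirkhoffSum T g n (T x))

theorem maxBirkhoffSum_nonneg (T : Ω → Ω) (g : Ω → ℝ) (n : ℕ) (x : Ω) :
    0 ≤ maxBirkhoffSum T g n x := by
  cases n with
  | zero => exact le_rfl
  | succ n => exact le_max_left _ _

theorem maxBirkhoffSum_le_succ (T : Ω → Ω) (g : Ω → ℝ) (n : ℕ) (x : Ω) :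
    maxBirkhoffSum T g n x ≤ maxBirkhoffSum T g (n + 1) x := by
  induction n generalizing x with
  | zero => exact le_max_left _ _
  | succ n ih => exact max_le_max le_rfl (add_le_add le_rfl (ih (T x)))

theorem birkhoffSum_le_maxBirkhoffSum (T : Ω → Ω) (g : Ω → ℝ) (n : ℕ) (x : Ω) :
    birkhoffSum T g n x ≤ maxBirkhoffSum T g n x := by
  induction n generalizing x with
  | zero => simp [maxBirkhoffSum]
  | succ n ih =>
    rw [birkhoffSum_succ']
    exact (add_le_add le_rfl (ih (T x))).trans (le_max_right _ _)

variable [MeasurableSpace Ω] {μ : Measure Ω} {T : Ω → Ω} {g : Ω → ℝ}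

theorem integrable_maxBirkhoffSum [IsFiniteMeasure μ] (hT : MeasurePreserving T μ μ)
    (hg : Integrable g μ) (n : ℕ) : Integrable (maxBirkhoffSum T g n) μ := by
  induction n with
  | zero => exact integrable_zero _ _ _
  | succ n ih =>
    exact (integrable_zero _ _ _).sup (hg.add (hT.integrable_comp_of_integrable ih))

/-- A form of the maximal ergodic theorem: if almost all sequences of Birkhoff sums of `g` are
unbounded above, then the integral of `g` is nonnegative. -/
theorem integral_nonneg_of_not_bddAbove_birkhoffSum [IsFiniteMeasure μ]
    (hT : MeasurePreserving T μ μ) (hg : Integrable g μ)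
    (h : ∀ᵐ x ∂μ, ¬ BddAbove (Set.range fun n => birkhoffSum T g n x)) : 0 ≤ ∫ x, g x ∂μ := by
  have hint : ∀ n, Integrable (fun x => maxBirkhoffSum T g n (T x)) μ := fun n =>
    hT.integrable_comp_of_integrable (integrable_maxBirkhoffSum hT hg n)
  -- The integrand is `max (-maxBirkhoffSum T g n (T x)) (g x)`. It is dominated by `|g x|` and
  -- equals `g x` once the running maximum at `T x` exceeds `-g x`.
  have hlim : Tendsto (fun n => ∫ x, (maxBirkhoffSum T g (n + 1) x - maxBirkhoffSum T g n (T x)) ∂μ)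
      atTop (𝓝 (∫ x, g x ∂μ)) := by
    refine tendsto_integral_of_dominated_convergence (fun x => |g x|) (fun n =>
      ((integrable_maxBirkhoffSum hT hg (n + 1)).sub (hint n)).aestronglyMeasurable) hg.abs
      (fun n => ae_of_all _ fun x => ?_) ?_
    · have h0 := maxBirkhoffSum_nonneg T g n (T x)
      simp only [maxBirkhoffSum, Real.norm_eq_abs]
      rcases le_total (g x + maxBirkhoffSum T g n (T x)) 0 with h1 | h1
      · rw [max_eq_left h1, abs_of_nonpos (by linarith)]
        linarith [neg_le_abs (g x)]
      · rw [max_eq_right h1]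
        simp
    · filter_upwards [hT.quasiMeasurePreserving.ae h] with x hx
      rw [not_bddAbove_iff] at hx
      obtain ⟨_, ⟨N, rfl⟩, hN⟩ := hx (-g x)
      refine tendsto_const_nhds.congr' ?_
      filter_upwards [eventually_ge_atTop N] with n hn
      have hmono : maxBirkhoffSum T g N (T x) ≤ maxBirkhoffSum T g n (T x) :=
        monotone_nat_of_le_succ (f := fun n => maxBirkhoffSum T g n (T x))
          (fun n => maxBirkhoffSum_le_succ T g n (T x)) hn
      have hle := birkhoffSum_le_maxBirkhoffSum T g N (T x)
      simp only [maxBirkhoffSum]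
      simp only at hN
      rw [max_eq_right (by linarith)]
      ring
  refine ge_of_tendsto' hlim fun n => ?_
  -- By invariance the integral becomes that of an increment of the running maximum, which is
  -- nonnegative.
  have hcomp : ∫ x, maxBirkhoffSum T g n (T x) ∂μ = ∫ x, maxBirkhoffSum T g n x ∂μ := by
    have hm := (integrable_maxBirkhoffSum hT hg n).aestronglyMeasurable
    conv_rhs => rw [← hT.map_eq]
    rw [integral_map hT.measurable.aemeasurable (by rwa [hT.map_eq])]
  rw [integral_sub (integrable_maxBirkhoffSum hT hg (n + 1)) (hint n), hcomp, sub_nonneg]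
  exact integral_mono (integrable_maxBirkhoffSum hT hg n) (integrable_maxBirkhoffSum hT hg (n + 1))
    fun x => maxBirkhoffSum_le_succ T g n x

/-- The points at which the Birkhoff sums of `g` are unbounded above. -/
def unboundedSet (T : Ω → Ω) (g : Ω → ℝ) : Set Ω :=
  {x | ¬ BddAbove (Set.range fun n => birkhoffSum T g n x)}

omit [MeasurableSpace Ω] in
-- The Birkhoff sums at `x` and at `T x` differ by an index shift and the constant `g x`. Exact
-- invariance allows `μ` to be restricted to such sets.
theorem preimage_unboundedSet (T : Ω → Ω) (g : Ω → ℝ) :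
    T ⁻¹' unboundedSet T g = unboundedSet T g := by
  ext x
  simp only [unboundedSet, Set.mem_preimage, Set.mem_ofPred_eq, not_iff_not]
  constructor
  · rintro ⟨B, hB⟩
    refine ⟨max 0 (g x + B), ?_⟩
    rintro _ ⟨n, rfl⟩
    cases n with
    | zero => simp
    | succ n =>
      simp only [birkhoffSum_succ']
      exact le_max_of_le_right (add_le_add le_rfl (hB ⟨n, rfl⟩))
  · rintro ⟨B, hB⟩
    refine ⟨B - g x, ?_⟩
    rintro _ ⟨n, rfl⟩
    have := hB ⟨n + 1, rfl⟩
    simp only [birkhoffSum_succ'] at this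
    simp only
    linarith

theorem measurable_birkhoffSum (hT : Measurable T) (hg : Measurable g) (n : ℕ) :
    Measurable (birkhoffSum T g n) :=
  Finset.measurable_fun_sum _ fun k _ => hg.comp (hT.iterate k)

theorem measurableSet_unboundedSet (hT : Measurable T) (hg : Measurable g) :
    MeasurableSet (unboundedSet T g) := by
  have : unboundedSet T g = ⋂ B : ℕ, ⋃ n, {x | (B : ℝ) < birkhoffSum T g n x} := by
    ext x
    simp only [unboundedSet, Set.mem_ofPred_eq, not_bddAbove_iff, Set.exists_range_iff,
      Set.mem_iInter, Set.mem_iUnion]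
    refine ⟨fun h B => h B, fun h B => ?_⟩
    obtain ⟨n, hn⟩ := h ⌈B⌉₊
    exact ⟨n, (Nat.le_ceil B).trans_lt hn⟩
  rw [this]
  exact .iInter fun B => .iUnion fun n =>
    measurableSet_lt measurable_const (measurable_birkhoffSum hT hg n)

theorem setIntegral_nonneg_of_subset_unboundedSet [IsFiniteMeasure μ]
    (hT : MeasurePreserving T μ μ) (hg : Integrable g μ) {I : Set Ω} (hI : MeasurableSet I)
    (hTI : T ⁻¹' I = I) (hsub : I ⊆ unboundedSet T g) : 0 ≤ ∫ x in I, g x ∂μ := by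
  refine integral_nonneg_of_not_bddAbove_birkhoffSum (T := T) ?_ hg.restrict ?_
  · have := hT.restrict_preimage hI
    rwa [hTI] at this
  · filter_upwards [ae_restrict_mem hI] with x hx using hsub hx

/-- The maximal theorem on this invariant set `I` gives `b * μ I ≤ ∫ x in I, g x ≤ a * μ I` with `a
< b`. This excludes averages that oscillate across `[a, b]`. -/
theorem measure_inter_unboundedSet_eq_zero [IsFiniteMeasure μ] (hT : MeasurePreserving T μ μ)
    (hgm : Measurable g) (hg : Integrable g μ) {a b : ℝ} (hab : a < b) :
    μ (unboundedSet T (fun x => g x - b) ∩ unboundedSet T (fun x => a - g x)) = 0 := by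
  set I := unboundedSet T (fun x => g x - b) ∩ unboundedSet T (fun x => a - g x) with hIdef
  have hI : MeasurableSet I :=
    (measurableSet_unboundedSet hT.measurable (hgm.sub_const b)).inter
      (measurableSet_unboundedSet hT.measurable (hgm.const_sub a))
  have hTI : T ⁻¹' I = I := by
    rw [hIdef, Set.preimage_inter, preimage_unboundedSet, preimage_unboundedSet]
  have hb := setIntegral_nonneg_of_subset_unboundedSet hT (hg.sub (integrable_const b)) hI hTI
    Set.inter_subset_left
  have ha := setIntegral_nonneg_of_subset_unboundedSet hT ((integrable_const a).sub hg) hI hTI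
    Set.inter_subset_right
  simp only [Pi.sub_apply] at ha hb
  rw [integral_sub hg.restrict (integrable_const b), setIntegral_const] at hb
  rw [integral_sub (integrable_const a) hg.restrict, setIntegral_const] at ha
  simp only [smul_eq_mul] at ha hb
  have h0 : μ.real I = 0 := by
    refine le_antisymm (not_lt.1 fun hpos => ?_) measureReal_nonneg
    linarith [mul_lt_mul_of_pos_left hab hpos]
  exact (measureReal_eq_zero_iff (by finiteness)).1 h0

/-- Here `b * μ I` stays below one fixed integral for all natural `b`. Applied to `g` and `-g`, this
bounds the averages on both sides. -/
theorem measure_iInter_unboundedSet_eq_zero [IsFiniteMeasure μ] (hT : MeasurePreserving T μ μ)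
    (hgm : Measurable g) (hg : Integrable g μ) :
    μ (⋂ b : ℕ, unboundedSet T (fun x => g x - b)) = 0 := by
  set I := ⋂ b : ℕ, unboundedSet T (fun x => g x - b) with hIdef
  have hI : MeasurableSet I :=
    .iInter fun b => measurableSet_unboundedSet hT.measurable (hgm.sub_const _)
  have hTI : T ⁻¹' I = I := by
    rw [hIdef, Set.preimage_iInter]
    simp only [preimage_unboundedSet]
  have hb : ∀ b : ℕ, μ.real I * b ≤ ∫ x in I, g x ∂μ := fun b => by
    have := setIntegral_nonneg_of_subset_unboundedSet hT (hg.sub (integrable_const (b : ℝ))) hI hTI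
      (Set.iInter_subset _ b)
    simp only [Pi.sub_apply] at this
    rw [integral_sub hg.restrict (integrable_const _), setIntegral_const] at this
    simpa using this
  have h0 : μ.real I = 0 := by
    by_contra hne
    have hpos : 0 < μ.real I := lt_of_le_of_ne measureReal_nonneg (Ne.symm hne)
    obtain ⟨n, hn⟩ := exists_nat_gt ((∫ x in I, g x ∂μ) / μ.real I)
    rw [div_lt_iff₀ hpos] at hn
    linarith [hb n]
  exact (measureReal_eq_zero_iff (by finiteness)).1 h0

omit [MeasurableSpace Ω] in
theorem birkhoffSum_sub_const (T : Ω → Ω) (g : Ω → ℝ) (b : ℝ) (n : ℕ) (x : Ω) :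
    birkhoffSum T (fun x => g x - b) n x = birkhoffSum T g n x - n * b := by
  simp [birkhoffSum, Finset.sum_sub_distrib]

omit [MeasurableSpace Ω] in
theorem mem_unboundedSet_of_frequently (T : Ω → Ω) (g : Ω → ℝ) {b c : ℝ} (hbc : b < c) {x : Ω}
    (h : ∃ᶠ n : ℕ in atTop, c < 1 / (n : ℝ) * birkhoffSum T g n x) :
    x ∈ unboundedSet T (fun x => g x - b) := by
  simp only [unboundedSet, Set.mem_ofPred_eq, not_bddAbove_iff, Set.exists_range_iff]
  intro B
  have hlarge : ∀ᶠ n : ℕ in atTop, B < n * (c - b) :=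
    (tendsto_natCast_atTop_atTop.atTop_mul_const (sub_pos.2 hbc)).eventually_gt_atTop B
  obtain ⟨n, hn, hB, hn0⟩ := (h.and_eventually (hlarge.and (eventually_gt_atTop 0))).exists
  refine ⟨n, ?_⟩
  have hn' : (0 : ℝ) < n := by exact_mod_cast hn0
  rw [birkhoffSum_sub_const]
  rw [one_div, ← div_eq_inv_mul, lt_div_iff₀ hn'] at hn
  linarith

omit [MeasurableSpace Ω] in
theorem isBoundedUnder_le_of_notMem_unboundedSet (T : Ω → Ω) (g : Ω → ℝ) {b : ℝ} {x : Ω}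
    (h : x ∉ unboundedSet T (fun x => g x - b)) :
    IsBoundedUnder (· ≤ ·) atTop (fun n : ℕ => 1 / (n : ℝ) * birkhoffSum T g n x) := by
  refine ⟨b + 1, ?_⟩
  by_contra hcon
  exact h (mem_unboundedSet_of_frequently T g (lt_add_one b)
    (by simpa [Filter.Frequently, eventually_map] using hcon))

/-- **Birkhoff's pointwise ergodic theorem**, without identification of the limit. -/
theorem ae_exists_tendsto_birkhoff [IsFiniteMeasure μ] (hT : MeasurePreserving T μ μ)
    (hgm : Measurable g) (hg : Integrable g μ) :
    ∀ᵐ x ∂μ, ∃ c, Tendsto (fun n : ℕ => 1 / (n : ℝ) * birkhoffSum T g n x) atTop (𝓝 c) := by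
  have h1 : ∀ᵐ x ∂μ, ∀ p q : ℚ, p < q →
      x ∉ unboundedSet T (fun x => g x - q) ∩ unboundedSet T (fun x => p - g x) := by
    rw [ae_all_iff]; intro p
    rw [ae_all_iff]; intro q
    by_cases hpq : p < q
    · have := measure_eq_zero_iff_ae_notMem.1
        (measure_inter_unboundedSet_eq_zero hT hgm hg (Rat.cast_lt (K := ℝ).2 hpq))
      filter_upwards [this] with x hx _ using hx
    · exact ae_of_all _ fun x h => absurd h hpq
  have h2 := measure_eq_zero_iff_ae_notMem.1 (measure_iInter_unboundedSet_eq_zero hT hgm hg)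
  have h3 := measure_eq_zero_iff_ae_notMem.1
    (measure_iInter_unboundedSet_eq_zero hT hgm.neg hg.neg)
  have hneg : ∀ x, ∀ n : ℕ, 1 / (n : ℝ) * birkhoffSum T (-g) n x
      = -(1 / (n : ℝ) * birkhoffSum T g n x) := fun x n => by
    simp [birkhoffSum]
  filter_upwards [h1, h2, h3] with x hx1 hx2 hx3
  simp only [Set.mem_iInter, not_forall] at hx2 hx3
  obtain ⟨B, hB⟩ := hx2
  obtain ⟨B', hB'⟩ := hx3
  refine tendsto_of_no_upcrossings (s := Set.range ((↑) : ℚ → ℝ)) Rat.denseRange_cast ?_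
    (isBoundedUnder_le_of_notMem_unboundedSet T g hB) ?_
  · rintro _ ⟨p, rfl⟩ _ ⟨q, rfl⟩ hpq ⟨hp, hq⟩
    -- Crossing a level infinitely often yields unbounded sums only at a strictly weaker level,
    -- hence the two intermediate rationals.
    obtain ⟨r, hpr, hrq⟩ := exists_rat_btwn hpq
    obtain ⟨s, hrs, hsq⟩ := exists_rat_btwn hrq
    refine hx1 r s (by exact_mod_cast hrs) ⟨mem_unboundedSet_of_frequently T g hsq hq, ?_⟩
    have := mem_unboundedSet_of_frequently T (-g) (neg_lt_neg hpr)
      (hp.mono fun n hn => by rw [hneg]; linarith)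
    convert this using 2
    ext y
    simp only [Pi.neg_apply]
    ring
  · have := isBoundedUnder_le_of_notMem_unboundedSet T (-g) hB'
    simp only [hneg] at this
    simpa using this

/-- A coboundary `φ ∘ T - φ` that is bounded below is integrable, provided `φ` is bounded above;
here in the form that the nonnegative function `φ ∘ T - φ + K` has finite integral. -/
theorem lintegral_coboundary_add_const_lt_top [IsFiniteMeasure μ] (hT : MeasurePreserving T μ μ)
    {φ : Ω → ℝ} (hφm : Measurable φ) (hφ : ∀ᵐ x ∂μ, φ x ≤ 0) {K : ℝ} (hK : 0 ≤ K)
    (h : ∀ᵐ x ∂μ, φ x - K ≤ φ (T x)) :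
    ∫⁻ x, ENNReal.ofReal (φ (T x) - φ x + K) ∂μ < ⊤ := by
  -- `φ` need not be integrable. Its truncations are bounded, so their coboundaries integrate to
  -- zero; the lower bound `-K` survives truncation because `0 ≤ K`. Fatou's lemma then removes the
  -- truncation.
  set ψ : ℕ → Ω → ℝ := fun N x => max (φ x) (-N)
  have hψm : ∀ N, Measurable (ψ N) := fun N => hφm.max measurable_const
  have hψi : ∀ N, Integrable (ψ N) μ := fun N => by
    refine Integrable.of_bound (hψm N).aestronglyMeasurable (N : ℝ) ?_
    filter_upwards [hφ] with x hx
    rw [Real.norm_eq_abs, abs_of_nonpos (max_le hx (by simp))]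
    linarith [le_max_right (φ x) (-(N : ℝ))]
  have hψTi : ∀ N, Integrable (fun x => ψ N (T x)) μ := fun N =>
    hT.integrable_comp_of_integrable (hψi N)
  have hval : ∀ N, ∫⁻ x, ENNReal.ofReal (ψ N (T x) - ψ N x + K) ∂μ
      = ENNReal.ofReal (K * μ.real Set.univ) := fun N => by
    have hi : Integrable (fun x => ψ N (T x) - ψ N x + K) μ :=
      ((hψTi N).sub (hψi N)).add (integrable_const K)
    rw [← ofReal_integral_eq_lintegral_ofReal hi]
    · congr 1
      have hcomp : ∫ x, ψ N (T x) ∂μ = ∫ x, ψ N x ∂μ := by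
        conv_rhs => rw [← hT.map_eq]
        rw [integral_map hT.measurable.aemeasurable (hψm N).aestronglyMeasurable]
      rw [integral_add (by exact (hψTi N).sub (hψi N)) (integrable_const K),
        integral_sub (hψTi N) (hψi N), hcomp]
      simp [mul_comm]
    · filter_upwards [h] with x hx
      have : ψ N x ≤ ψ N (T x) + K := by
        refine max_le ?_ ?_
        · linarith [le_max_left (φ (T x)) (-(N : ℝ))]
        · linarith [le_max_right (φ (T x)) (-(N : ℝ))]
      simp only [Pi.zero_apply]
      linarith
  have hev : ∀ x, ∀ᶠ N : ℕ in atTop, ψ N x = φ x := fun x => by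
    obtain ⟨N₀, hN₀⟩ := exists_nat_ge (-φ x)
    filter_upwards [eventually_ge_atTop N₀] with N hN
    have : (N₀ : ℝ) ≤ N := by exact_mod_cast hN
    exact max_eq_left (by linarith)
  calc ∫⁻ x, ENNReal.ofReal (φ (T x) - φ x + K) ∂μ
      = ∫⁻ x, liminf (fun N => ENNReal.ofReal (ψ N (T x) - ψ N x + K)) atTop ∂μ := by
        refine lintegral_congr fun x => (Tendsto.liminf_eq ?_).symm
        refine tendsto_const_nhds.congr' ?_
        filter_upwards [hev x, hev (T x)] with N h1 h2
        rw [h1, h2]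
    _ ≤ liminf (fun N => ∫⁻ x, ENNReal.ofReal (ψ N (T x) - ψ N x + K) ∂μ) atTop :=
        lintegral_liminf_le fun N => ENNReal.measurable_ofReal.comp
          ((((hψm N).comp hT.measurable).sub (hψm N)).add_const K)
    _ < ⊤ := by
        simp only [hval, liminf_const]
        exact ENNReal.ofReal_lt_top

end Birkhoff

/-! ### Invariant measures by averaging along an orbit -/

section KrylovBogolyubov

variable {Z : Type*} [MeasurableSpace Z]

/-- The empirical measure of the first `n + 1` points of the orbit of `z`. -/
def empiricalMeasure (A : Z → Z) (z : Z) (n : ℕ) : Measure Z :=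
  ENNReal.ofReal ((n + 1 : ℝ)⁻¹) • ∑ k ∈ Finset.range (n + 1), Measure.dirac (A^[k] z)

theorem empiricalMeasure_apply (A : Z → Z) (z : Z) (n : ℕ) {s : Set Z} (hs : MeasurableSet s) :
    empiricalMeasure A z n s = ENNReal.ofReal
      ((n + 1 : ℝ)⁻¹ * birkhoffSum A (s.indicator fun _ => (1 : ℝ)) (n + 1) z) := by
  rw [empiricalMeasure, Measure.smul_apply, Measure.finsetSum_apply, smul_eq_mul,
    ENNReal.ofReal_mul (by positivity), birkhoffSum,
    ENNReal.ofReal_sum_of_nonneg fun k _ => Set.indicator_nonneg (fun _ _ => zero_le_one) _]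
  congr 1
  refine Finset.sum_congr rfl fun k _ => ?_
  rw [Measure.dirac_apply' _ hs]
  by_cases h : A^[k] z ∈ s <;> simp [h]

instance isProbabilityMeasure_empiricalMeasure (A : Z → Z) (z : Z) (n : ℕ) :
    IsProbabilityMeasure (empiricalMeasure A z n) := by
  refine ⟨?_⟩
  rw [empiricalMeasure_apply A z n MeasurableSet.univ]
  have : (n + 1 : ℝ)⁻¹ * (n + 1) = 1 := inv_mul_cancel₀ (by positivity)
  simp [birkhoffSum, this]

theorem integral_empiricalMeasure (A : Z → Z) (z : Z) (n : ℕ) {f : Z → ℝ}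
    (hf : StronglyMeasurable f) :
    ∫ x, f x ∂empiricalMeasure A z n = (n + 1 : ℝ)⁻¹ * birkhoffSum A f (n + 1) z := by
  rw [empiricalMeasure, integral_smul_measure, integral_finsetSum_measure, smul_eq_mul,
    ENNReal.toReal_ofReal (by positivity)]
  · simp only [birkhoffSum, integral_dirac' _ _ hf]
  · exact fun k _ => integrable_dirac' hf enorm_lt_top

variable [TopologicalSpace Z] [BorelSpace Z] [T2Space Z] [HasOuterApproxClosed Z]

/-- The **Krylov–Bogolyubov theorem** with a Lyapunov function: a continuous map has an invariant
probability measure if along one orbit the averages of a nonnegative function with compact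
sublevel sets are bounded. -/
theorem exists_measurePreserving_of_birkhoffSum_le {A : Z → Z} (hA : Continuous A) {V : Z → ℝ}
    (hV : ∀ x, 0 ≤ V x) (hVc : ∀ c, IsCompact {x | V x ≤ c}) (z : Z) (K : ℝ)
    (hK : ∀ n, birkhoffSum A V (n + 1) z ≤ K * (n + 1)) :
    ∃ ν : Measure Z, IsProbabilityMeasure ν ∧ MeasurePreserving A ν ν := by
  set P : ℕ → ProbabilityMeasure Z := fun n => ⟨empiricalMeasure A z n, inferInstance⟩
  have htight : IsTightMeasureSet
      {((μ : ProbabilityMeasure Z) : Measure Z) | μ ∈ Set.range P} := by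
    rw [isTightMeasureSet_iff_exists_isCompact_measure_compl_le]
    intro ε hε
    obtain ⟨δ, hδ, hδε⟩ : ∃ δ : ℝ, 0 < δ ∧ ENNReal.ofReal δ ≤ ε := by
      rcases eq_or_ne ε ⊤ with rfl | htop
      · exact ⟨1, one_pos, le_top⟩
      · exact ⟨ε.toReal, ENNReal.toReal_pos hε.ne' htop, ENNReal.ofReal_toReal_le⟩
    -- Markov's inequality puts mass at most `K / c ≤ δ` outside `{V ≤ c}`; the summand 1 keeps `c`
    -- positive when `K = 0`.
    set c : ℝ := |K| / δ + 1
    have hc : 0 < c := by positivity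
    have hKc : |K| ≤ δ * c := by
      have : δ * (|K| / δ) = |K| := mul_div_cancel₀ _ hδ.ne'
      simp only [c]
      linarith
    refine ⟨_, hVc c, ?_⟩
    rintro _ ⟨_, ⟨n, rfl⟩, rfl⟩
    refine le_trans ?_ hδε
    change empiricalMeasure A z n _ ≤ _
    rw [empiricalMeasure_apply A z n (hVc c).measurableSet.compl]
    refine ENNReal.ofReal_le_ofReal ?_
    have hn : (0 : ℝ) < n + 1 := by positivity
    rw [inv_mul_le_iff₀ hn]
    have hmarkov : c * birkhoffSum A ({x | V x ≤ c}ᶜ.indicator fun _ => (1 : ℝ)) (n + 1) z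
        ≤ birkhoffSum A V (n + 1) z := by
      rw [birkhoffSum, birkhoffSum, Finset.mul_sum]
      refine Finset.sum_le_sum fun k _ => ?_
      by_cases h : V (A^[k] z) ≤ c
      · simpa [h] using hV _
      · simpa [h] using (not_le.1 h).le
    have h1 := hmarkov.trans (hK n)
    have h2 : K * (n + 1) ≤ c * ((n + 1) * δ) := by
      nlinarith [mul_le_mul_of_nonneg_right ((le_abs_self K).trans hKc) hn.le]
    exact le_of_mul_le_mul_left (h1.trans h2) hc
  have hcomp := isCompact_closure_of_isTightMeasureSet htight
  obtain ⟨ν, -, hν⟩ := hcomp.exists_mapClusterPt (f := atTop) (u := P)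
    (le_principal_iff.2 (mem_map.2 (univ_mem' fun n => subset_closure ⟨n, rfl⟩)))
  obtain ⟨U, hU, hUν⟩ := mapClusterPt_iff_ultrafilter.1 hν
  have hAν : ν.map hA.measurable.aemeasurable = ν := by
    have hleft : Tendsto (fun n => (P n).map hA.measurable.aemeasurable) U
        (𝓝 (ν.map hA.measurable.aemeasurable)) :=
      ((ProbabilityMeasure.continuous_map hA).tendsto ν).comp hUν
    refine tendsto_nhds_unique hleft ?_
    rw [ProbabilityMeasure.tendsto_iff_forall_integral_tendsto] at hUν ⊢
    intro f
    have hfm : StronglyMeasurable f := f.continuous.measurable.stronglyMeasurable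
    have hfAm : StronglyMeasurable (fun x => f (A x)) :=
      (f.continuous.comp hA).measurable.stronglyMeasurable
    -- The empirical integrals of `f ∘ A` and `f` differ only by the two end terms of the orbit.
    have hdiff : Tendsto (fun n : ℕ => (n + 1 : ℝ)⁻¹ * (f (A^[n + 1] z) - f z)) U (𝓝 0) := by
      refine Tendsto.mono_left ?_ hU
      refine squeeze_zero_norm (a := fun n : ℕ => 1 / ((n : ℝ) + 1) * (2 * ‖f‖)) (fun n => ?_) ?_
      · rw [norm_mul, one_div, Real.norm_of_nonneg (by positivity)]
        gcongr
        linarith [norm_sub_le (f (A^[n + 1] z)) (f z), f.norm_coe_le_norm (A^[n + 1] z),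
          f.norm_coe_le_norm z]
      · simpa using tendsto_one_div_add_atTop_nhds_zero_nat.mul_const (2 * ‖f‖)
    have := (hUν f).add hdiff
    rw [add_zero] at this
    refine this.congr fun n => ?_
    change ∫ x, f x ∂empiricalMeasure A z n + _
      = ∫ x, f x ∂(Measure.map A (empiricalMeasure A z n))
    rw [integral_map hA.measurable.aemeasurable hfm.aestronglyMeasurable,
      integral_empiricalMeasure A z n hfm, integral_empiricalMeasure A z n hfAm, ← mul_add]
    congr 1
    have h1 := Finset.sum_range_succ' (fun k => f (A^[k] z)) (n + 1)
    rw [Finset.sum_range_succ] at h1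
    simp only [birkhoffSum, ← Function.iterate_succ_apply' A]
    simp only [Function.iterate_zero, id] at h1
    linarith
  exact ⟨ν, inferInstance, hA.measurable, congrArg Subtype.val hAν⟩

end KrylovBogolyubov

/-! ### Elementary properties of the weight update -/

section Update

variable {m : ℕ} {M : Finset (Row m)} {sel : Finset (Row m) → Row m}

theorem continuous_err (η : Row m) : Continuous η.err := by
  unfold Row.err
  refine continuous_finsetSum _ fun i _ => ?_
  split_ifs
  · exact continuous_apply i
  · exact continuous_const

theorem err_add_correct (η : Row m) {w : Fin m → ℝ} (hw : w ∈ stdSimplex ℝ (Fin m)) :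
    η.err w + ∑ i, (if η i = true then 0 else w i) = 1 := by
  rw [Row.err, ← Finset.sum_add_distrib, ← hw.2]
  refine Finset.sum_congr rfl fun i _ => ?_
  split_ifs <;> simp

theorem err_le_one (η : Row m) {w : Fin m → ℝ} (hw : w ∈ stdSimplex ℝ (Fin m)) :
    η.err w ≤ 1 := by
  rw [← err_add_correct η hw]
  refine le_add_of_nonneg_right (Finset.sum_nonneg fun i _ => ?_)
  split_ifs
  exacts [le_rfl, hw.1 i]

theorem argminRows_subset (M : Finset (Row m)) (w : Fin m → ℝ) : argminRows M w ⊆ M :=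
  Finset.filter_subset _ _

theorem argminRows_nonempty (hM : M.Nonempty) (w : Fin m → ℝ) : (argminRows M w).Nonempty := by
  obtain ⟨η, hη, h⟩ := M.exists_min_image (fun η : Row m => η.err w) hM
  exact ⟨η, Finset.mem_filter.2 ⟨hη, h⟩⟩

theorem best_mem_argminRows (hsel : IsTieBreaker M sel) (hM : M.Nonempty) (w : Fin m → ℝ) :
    best M sel w ∈ argminRows M w :=
  hsel _ (argminRows_subset M w) (argminRows_nonempty hM w)

theorem best_mem (hsel : IsTieBreaker M sel) (hM : M.Nonempty) (w : Fin m → ℝ) :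
    best M sel w ∈ M :=
  argminRows_subset M w (best_mem_argminRows hsel hM w)

theorem err_best_le (hsel : IsTieBreaker M sel) {w : Fin m → ℝ} {η : Row m} (hη : η ∈ M) :
    (best M sel w).err w ≤ η.err w :=
  (Finset.mem_filter.1 (best_mem_argminRows hsel ⟨η, hη⟩ w)).2 η hη

theorem minErr_eq_err_best (hsel : IsTieBreaker M sel) (hM : M.Nonempty) (w : Fin m → ℝ) :
    minErr M w = (best M sel w).err w := by
  refine IsLeast.csInf_eq ⟨⟨_, best_mem hsel hM w, rfl⟩, ?_⟩
  rintro _ ⟨η, hη, rfl⟩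
  exact err_best_le hsel hη

theorem WeakLearning.nonempty (h : WeakLearning M) {w : Fin m → ℝ}
    (hw : w ∈ stdSimplex ℝ (Fin m)) : M.Nonempty := by
  obtain ⟨γ, -, hγ⟩ := h
  obtain ⟨η, hη, -⟩ := hγ w hw
  exact ⟨η, hη⟩

theorem err_best_lt_half (hsel : IsTieBreaker M sel) (h : WeakLearning M) {w : Fin m → ℝ}
    (hw : w ∈ stdSimplex ℝ (Fin m)) : (best M sel w).err w < 1 / 2 := by
  obtain ⟨γ, hγ0, hγ⟩ := h
  obtain ⟨η, hη, hlt⟩ := hγ w hw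
  linarith [err_best_le (w := w) hsel hη]

theorem hypUpdate_mem_stdSimplex {η : Row m} {w : Fin m → ℝ} (hw : w ∈ stdSimplex ℝ (Fin m))
    (h0 : 0 < η.err w) (h1 : η.err w < 1) : hypUpdate η w ∈ stdSimplex ℝ (Fin m) := by
  have h1' : 0 < 1 - η.err w := sub_pos.2 h1
  refine ⟨fun i => ?_, ?_⟩
  · have := hw.1 i
    unfold hypUpdate
    split_ifs <;> positivity
  · have hsplit : ∀ i, hypUpdate η w i = 1 / 2 * (1 / η.err w) * (if η i = true then w i else 0)
        + 1 / 2 * (1 / (1 - η.err w)) * (if η i = true then 0 else w i) := fun i => by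
      unfold hypUpdate
      split_ifs <;> ring
    have hc := eq_sub_of_add_eq' (err_add_correct η hw)
    rw [Finset.sum_congr rfl fun i _ => hsplit i, Finset.sum_add_distrib, ← Finset.mul_sum,
      ← Finset.mul_sum, hc, ← Row.err]
    field_simp
    norm_num

theorem err_hypUpdate_self {η : Row m} {w : Fin m → ℝ} (h0 : 0 < η.err w) :
    η.err (hypUpdate η w) = 1 / 2 := by
  have : η.err (hypUpdate η w) = 1 / 2 * (1 / η.err w) * η.err w := by
    conv_rhs => rw [Row.err.eq_1 η w, Finset.mul_sum]
    refine Finset.sum_congr rfl fun i _ => ?_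
    unfold hypUpdate
    rw [← Row.err.eq_1]
    split_ifs <;> ring
  rw [this]
  field_simp

/-- Both normalising factors are at least 1, so every coordinate keeps at least half its weight. -/
theorem half_err_le_err_hypUpdate {η : Row m} (η' : Row m) {w : Fin m → ℝ}
    (hw : w ∈ stdSimplex ℝ (Fin m)) (h0 : 0 < η.err w) (h1 : η.err w < 1) :
    1 / 2 * η'.err w ≤ η'.err (hypUpdate η w) := by
  have h1' : 0 < 1 - η.err w := sub_pos.2 h1
  rw [Row.err, Finset.mul_sum]
  refine Finset.sum_le_sum fun i _ => ?_
  have hi := hw.1 i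
  split_ifs with h
  · have hle : ∀ e : ℝ, 0 < e → e ≤ 1 → 1 / 2 * w i ≤ 1 / 2 * w i * (1 / e) := fun e he he1 =>
      le_mul_of_one_le_right (by positivity) ((one_le_div he).2 he1)
    unfold hypUpdate
    split_ifs
    · exact hle _ h0 h1.le
    · exact hle _ h1' (by linarith)
  · simp

theorem update_mem_sigmaZero (hsel : IsTieBreaker M sel) (h : WeakLearning M) {w : Fin m → ℝ}
    (hw : w ∈ sigmaZero M) : update M sel w ∈ sigmaZero M := by
  have h0 := hw.2 _ (best_mem hsel (h.nonempty hw.1) w)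
  have h1 := (err_best_lt_half hsel h hw.1).trans one_half_lt_one
  refine ⟨hypUpdate_mem_stdSimplex hw.1 h0 h1, fun η hη => ?_⟩
  exact (by have := hw.2 η hη; positivity : 0 < 1 / 2 * η.err w).trans_le
    (half_err_le_err_hypUpdate η hw.1 h0 h1)

theorem weights_mem_sigmaZero (hsel : IsTieBreaker M sel) (h : WeakLearning M) {w : Fin m → ℝ}
    (hw : w ∈ sigmaZero M) (t : ℕ) : weights M sel w t ∈ sigmaZero M := by
  have hmaps : Set.MapsTo (update M sel) (sigmaZero M) (sigmaZero M) := fun w hw =>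
    update_mem_sigmaZero hsel h hw
  exact hmaps.iterate t hw

/-- The weight vanishes wherever the rows disagree. Under the second alternative of the no-ties
condition, the choice between such rows is thus immaterial. -/
theorem hypUpdate_eq_of_sum_eq_zero {η η' : Row m} {w : Fin m → ℝ}
    (hw : w ∈ stdSimplex ℝ (Fin m)) (h : ∑ i, (if η i ≠ η' i then w i else 0) = 0) :
    hypUpdate η w = hypUpdate η' w := by
  have hz : ∀ i, η i ≠ η' i → w i = 0 := fun i hi => by
    have := (Finset.sum_eq_zero_iff_of_nonneg (fun i _ => by
      split_ifs
      exacts [hw.1 i, le_rfl])).1 h i (Finset.mem_univ i)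
    simpa [hi] using this
  have herr : η.err w = η'.err w := Finset.sum_congr rfl fun i _ => by
    by_cases hi : η i = η' i
    · rw [hi]
    · simp [hz i hi]
  funext i
  by_cases hi : η i = η' i
  · simp only [hypUpdate, hi, herr]
  · simp [hypUpdate, hz i hi]

theorem continuousAt_hypUpdate {η : Row m} {w : Fin m → ℝ} (h0 : η.err w ≠ 0)
    (h1 : η.err w ≠ 1) : ContinuousAt (hypUpdate η) w := by
  rw [continuousAt_pi]
  intro i
  have hw : ContinuousAt (fun w : Fin m → ℝ => w i) w := (continuous_apply i).continuousAt
  have he : ContinuousAt η.err w := (continuous_err η).continuousAt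
  unfold hypUpdate
  split_ifs
  · exact (continuousAt_const.mul hw).mul (continuousAt_const.div he h0)
  · exact (continuousAt_const.mul hw).mul
      (continuousAt_const.div (continuousAt_const.sub he) (sub_ne_zero.2 h1.symm))

/-- A row that is strictly beaten at `w` is still beaten nearby, and there are finitely many rows.
-/
theorem eventually_argminRows_subset (M : Finset (Row m)) (w : Fin m → ℝ) :
    ∀ᶠ v in 𝓝 w, argminRows M v ⊆ argminRows M w := by
  have hev : ∀ᶠ v in 𝓝 w, ∀ η ∈ M, η ∉ argminRows M w → η ∉ argminRows M v := by
    rw [eventually_all_finset]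
    intro η hη
    by_cases hmem : η ∈ argminRows M w
    · exact .of_forall fun v h => absurd hmem h
    · obtain ⟨η', hη', hlt⟩ : ∃ η' ∈ M, η'.err w < η.err w := by
        simpa [argminRows, hη] using hmem
      filter_upwards [(continuous_err η').continuousAt.eventually_lt
        (continuous_err η).continuousAt hlt] with v hv _ hmin
      exact absurd ((Finset.mem_filter.1 hmin).2 η' hη') (not_le.2 hv)
  filter_upwards [hev] with v hv η hη
  by_contra hcon
  exact hv η (argminRows_subset M v hη) hcon hη

/-- On the set `G` of the no-ties condition the weight update is continuous. -/
theorem continuousWithinAt_update (hsel : IsTieBreaker M sel) (h : WeakLearning M)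
    {G : Set (Fin m → ℝ)} (hG : G ⊆ stdSimplex ℝ (Fin m))
    (hties : ∀ η ∈ M, ∀ η' ∈ M, sigma M η ∩ sigma M η' ∩ G = ∅ ∨
      ∀ w ∈ G, ∑ i, (if η i ≠ η' i then w i else 0) = 0)
    {w : Fin m → ℝ} (hwG : w ∈ G) (hw : w ∈ sigmaZero M) :
    ContinuousWithinAt (update M sel) G w := by
  have hM := h.nonempty hw.1
  have hcont : ContinuousAt (hypUpdate (best M sel w)) w :=
    continuousAt_hypUpdate (hw.2 _ (best_mem hsel hM w)).ne'
      ((err_best_lt_half hsel h hw.1).trans one_half_lt_one).ne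
  refine hcont.continuousWithinAt.congr_of_eventuallyEq ?_ rfl
  filter_upwards [self_mem_nhdsWithin,
    mem_nhdsWithin_of_mem_nhds (eventually_argminRows_subset M w)] with v hvG hv
  -- The row selected at `v` is also optimal at `w`, so `w` itself refutes the disjointness
  -- alternative.
  have hmem := hv (best_mem_argminRows hsel hM v)
  refine hypUpdate_eq_of_sum_eq_zero (hG hvG) ?_
  refine (hties _ (best_mem hsel hM v) _ (best_mem hsel hM w)).resolve_left (fun hempty => ?_) v hvG
  exact Set.notMem_empty w (hempty ▸ ⟨⟨⟨hw.1, hmem⟩, hw.1, best_mem_argminRows hsel hM w⟩, hwG⟩)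

/-! ### Measurability -/

theorem measurable_minErr (M : Finset (Row m)) : Measurable (minErr M) := by
  have : minErr M = fun w => ⨅ η : (M : Set (Row m)), (η : Row m).err w := by
    funext w
    exact sInf_image'
  rw [this]
  exact Measurable.iInf fun η => (continuous_err _).measurable

theorem measurable_alpha (M : Finset (Row m)) : Measurable (alpha M) :=
  ((((measurable_minErr M).const_sub 1).div (measurable_minErr M)).log).const_mul _

theorem measurableSet_argminRows_eq (M A : Finset (Row m)) :
    MeasurableSet {w | argminRows M w = A} := by
  have hmem : ∀ η : Row m, MeasurableSet {w | η ∈ argminRows M w} := fun η => by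
    have hset : {w | η ∈ argminRows M w}
        = {_w | η ∈ M} ∩ ⋂ η' ∈ M, {w | η.err w ≤ η'.err w} := by
      ext w
      simp [argminRows]
    rw [hset]
    exact (MeasurableSet.const _).inter (.biInter (Finset.countable_toSet M) fun η' _ =>
      measurableSet_le (continuous_err η).measurable (continuous_err η').measurable)
  simp only [Finset.ext_iff]
  exact measurableSet_setOfPred.2 (Measurable.forall fun η =>
    (measurableSet_setOfPred.1 (hmem η)).iff measurable_const)

/-- However irregular `sel` is, it sees `w` only through the set of optimal rows, which takes
finitely many values. -/
theorem measurableSet_best_eq (M : Finset (Row m)) (sel : Finset (Row m) → Row m) (η : Row m) :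
    MeasurableSet {w | η = best M sel w} := by
  have : {w | η = best M sel w} = ⋃ A : Finset (Row m), ⋃ _ : η = sel A,
      {w | argminRows M w = A} := by
    ext w
    simp [best]
  rw [this]
  exact .iUnion fun A => .iUnion fun _ => measurableSet_argminRows_eq M A

theorem measurableSet_sigmaStar (M : Finset (Row m)) (sel : Finset (Row m) → Row m) (η : Row m) :
    MeasurableSet (sigmaStar M sel η) :=
  (isClosed_stdSimplex ℝ (Fin m)).measurableSet.inter (measurableSet_best_eq M sel η)

theorem measurableSet_sigmaZero (M : Finset (Row m)) : MeasurableSet (sigmaZero M) := by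
  have : sigmaZero M = stdSimplex ℝ (Fin m) ∩ ⋂ η ∈ M, {w | 0 < η.err w} := by
    ext w
    simp [sigmaZero]
  rw [this]
  exact (isClosed_stdSimplex ℝ (Fin m)).measurableSet.inter
    (.biInter (Finset.countable_toSet M) fun η _ =>
      measurableSet_lt measurable_const (continuous_err η).measurable)

theorem measurable_hypUpdate (η : Row m) : Measurable (hypUpdate η) := by
  rw [measurable_pi_iff]
  intro i
  have he := (continuous_err η).measurable
  unfold hypUpdate
  split_ifs
  · exact ((measurable_pi_apply i).const_mul _).mul (he.const_div _)
  · exact ((measurable_pi_apply i).const_mul _).mul ((he.const_sub _).const_div _)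

theorem measurable_update (M : Finset (Row m)) (sel : Finset (Row m) → Row m) :
    Measurable (update M sel) := by
  have hpre : ∀ s, update M sel ⁻¹' s
      = ⋃ η : Row m, {w | η = best M sel w} ∩ hypUpdate η ⁻¹' s := fun s => by
    ext w
    simp [update]
  intro s hs
  rw [hpre]
  exact .iUnion fun η => (measurableSet_best_eq M sel η).inter (measurable_hypUpdate η hs)

end Update

/-! ### A Lyapunov function -/

section Potential

variable {m : ℕ} {M : Finset (Row m)} {sel : Finset (Row m) → Row m}

/-- The sum over all rows of the logarithms of the errors. -/
def potential (M : Finset (Row m)) (w : Fin m → ℝ) : ℝ :=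
  ∑ η ∈ M, Real.log (η.err w)

theorem measurable_potential (M : Finset (Row m)) : Measurable (potential M) :=
  Finset.measurable_fun_sum _ fun η _ => (continuous_err η).measurable.log

theorem potential_nonpos {w : Fin m → ℝ} (hw : w ∈ sigmaZero M) : potential M w ≤ 0 :=
  Finset.sum_nonpos fun η hη => Real.log_nonpos (hw.2 η hη).le (err_le_one η hw.1)

/-- The potential grows by at least `log (1 / ε)` in each round, up to a constant: the selected row
gets error `1 / 2`, and no error decreases by more than a factor of two. -/
theorem neg_log_err_best_le (hsel : IsTieBreaker M sel) (h : WeakLearning M) {w : Fin m → ℝ}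
    (hw : w ∈ sigmaZero M) :
    -Real.log ((best M sel w).err w)
      ≤ potential M (update M sel w) - potential M w + M.card * Real.log 2 := by
  have hb := best_mem hsel (h.nonempty hw.1) w
  have h0 := hw.2 _ hb
  have h1 := (err_best_lt_half hsel h hw.1).trans one_half_lt_one
  have hterm : ∀ η ∈ M, (if η = best M sel w then -Real.log ((best M sel w).err w) else 0)
      ≤ Real.log (η.err (update M sel w)) - Real.log (η.err w) + Real.log 2 := by
    intro η hη
    split_ifs with heq
    · rw [heq, update, err_hypUpdate_self h0, one_div, Real.log_inv]
      linarith
    · have hpos := hw.2 η hη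
      have := Real.log_le_log (by positivity) (half_err_le_err_hypUpdate η hw.1 h0 h1)
      rw [Real.log_mul (by norm_num) hpos.ne', one_div, Real.log_inv] at this
      rw [update]
      linarith
  have hsum := Finset.sum_le_sum hterm
  rw [Finset.sum_ite_eq' M, if_pos hb, Finset.sum_add_distrib, Finset.sum_sub_distrib,
    Finset.sum_const, nsmul_eq_mul] at hsum
  exact hsum

theorem alpha_nonneg (hsel : IsTieBreaker M sel) (h : WeakLearning M) {w : Fin m → ℝ}
    (hw : w ∈ sigmaZero M) : 0 ≤ alpha M w := by
  have hM := h.nonempty hw.1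
  have h0 := hw.2 _ (best_mem hsel hM w)
  have h1 := err_best_lt_half hsel h hw.1
  rw [alpha, minErr_eq_err_best hsel hM]
  have : 1 ≤ (1 - (best M sel w).err w) / (best M sel w).err w := by
    rw [one_le_div h0]
    linarith
  have := Real.log_nonneg this
  positivity

theorem alpha_le (hsel : IsTieBreaker M sel) (h : WeakLearning M) {w : Fin m → ℝ}
    (hw : w ∈ sigmaZero M) : alpha M w ≤ -Real.log ((best M sel w).err w) := by
  have hM := h.nonempty hw.1
  have h0 := hw.2 _ (best_mem hsel hM w)
  have h1 := err_best_lt_half hsel h hw.1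
  have hlog1 : Real.log (1 - (best M sel w).err w) ≤ 0 :=
    Real.log_nonpos (by linarith) (by linarith)
  have hlog2 : Real.log ((best M sel w).err w) ≤ 0 := Real.log_nonpos h0.le (by linarith)
  rw [alpha, minErr_eq_err_best hsel hM, Real.log_div (by linarith) h0.ne']
  linarith

/-- The dominating function is the coboundary of the potential plus a constant; it is nonnegative
because it lies above `alpha`. -/
theorem integrable_alpha (hsel : IsTieBreaker M sel) (h : WeakLearning M)
    {μ : Measure (Fin m → ℝ)} (hμ : IsInvariantProbability M sel μ) : Integrable (alpha M) μ := by
  obtain ⟨_, hμ0, hinv⟩ := hμ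
  have hK : 0 ≤ (M.card : ℝ) * Real.log 2 :=
    mul_nonneg (Nat.cast_nonneg _) (Real.log_nonneg one_le_two)
  have hbound : ∀ᵐ w ∂μ, 0 ≤ alpha M w ∧ alpha M w
      ≤ potential M (update M sel w) - potential M w + M.card * Real.log 2 := by
    filter_upwards [hμ0] with w hw
    exact ⟨alpha_nonneg hsel h hw, (alpha_le hsel h hw).trans (neg_log_err_best_le hsel h hw)⟩
  have hfin := lintegral_coboundary_add_const_lt_top hinv (measurable_potential M)
    (hμ0.mono fun w => potential_nonpos) hK
    (hbound.mono fun w hw => by linarith [hw.1.trans hw.2])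
  refine ⟨(measurable_alpha M).aestronglyMeasurable, ?_⟩
  rw [hasFiniteIntegral_iff_norm]
  refine lt_of_le_of_lt (lintegral_mono_ae ?_) hfin
  filter_upwards [hbound] with w hw
  rw [Real.norm_of_nonneg hw.1]
  exact ENNReal.ofReal_le_ofReal hw.2

theorem isCompact_inter_neg_log_err_le (M : Finset (Row m)) {F : Set (Fin m → ℝ)}
    (hF : IsCompact F) (c : ℝ) : IsCompact (F ∩ {w | ∀ η ∈ M, Real.exp (-c) ≤ η.err w}) := by
  refine hF.inter_right ?_
  simp only [Set.ofPred_forall]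
  exact isClosed_iInter fun η => isClosed_iInter fun _ =>
    isClosed_le continuous_const (continuous_err η)

end Potential

/-! ### Existence of an invariant probability measure -/

section Existence

variable {m : ℕ} {M : Finset (Row m)} {sel : Finset (Row m) → Row m}

theorem omegaInf_subset_sigmaZero (hsel : IsTieBreaker M sel) (h : WeakLearning M) :
    omegaInf M sel ⊆ sigmaZero M := by
  intro w hw
  obtain ⟨v, hv, rfl⟩ := Set.mem_iInter₂.1 hw 1 le_rfl
  exact update_mem_sigmaZero hsel h hv

theorem update_mem_omegaInf (hsel : IsTieBreaker M sel) (h : WeakLearning M) {w : Fin m → ℝ}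
    (hw : w ∈ omegaInf M sel) : update M sel w ∈ omegaInf M sel := by
  refine Set.mem_iInter₂.2 fun t ht => ?_
  obtain ⟨v, hv, rfl⟩ := Set.mem_iInter₂.1 hw t ht
  exact ⟨update M sel v, update_mem_sigmaZero hsel h hv, by
    rw [← Function.iterate_succ_apply, Function.iterate_succ_apply']⟩

theorem neg_log_err_best_le_iff (hsel : IsTieBreaker M sel) (hM : M.Nonempty) {w : Fin m → ℝ}
    (hw : w ∈ sigmaZero M) (c : ℝ) :
    -Real.log ((best M sel w).err w) ≤ c ↔ ∀ η ∈ M, Real.exp (-c) ≤ η.err w := by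
  have hb := best_mem hsel hM w
  rw [neg_le, Real.le_log_iff_exp_le (hw.2 _ hb)]
  exact ⟨fun h η hη => h.trans (err_best_le hsel hη), fun h => h _ hb⟩

theorem exists_isInvariantProbability (hsel : IsTieBreaker M sel) (h : WeakLearning M)
    (hties : EventuallyNoTies M sel) (hne : (omegaInf M sel).Nonempty) :
    ∃ μ : Measure (Fin m → ℝ), IsInvariantProbability M sel μ := by
  obtain ⟨w₀, hw₀⟩ := hne
  obtain ⟨G, hGs, hGc, hΩG, hG⟩ := hties
  have hw₀' := omegaInf_subset_sigmaZero hsel h hw₀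
  have hM := h.nonempty hw₀'.1
  have horb : Set.range (weights M sel w₀) ⊆ G := by
    rintro _ ⟨t, rfl⟩
    have hmaps : Set.MapsTo (update M sel) (omegaInf M sel) (omegaInf M sel) := fun w hw =>
      update_mem_omegaInf hsel h hw
    exact hΩG (hmaps.iterate t hw₀)
  set F := closure (Set.range (weights M sel w₀))
  have hFG : F ⊆ G := closure_minimal horb hGc.isClosed
  have hFc : IsCompact F := hGc.of_isClosed_subset isClosed_closure hFG
  -- The orbit closure may contain points with a zero error, where the update is meaningless.
  -- Removing them may destroy compactness, which the Lyapunov function `V` replaces.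
  set Z := F ∩ sigmaZero M
  have hcont : ∀ w ∈ Z, ContinuousWithinAt (update M sel) G w := fun w hw =>
    continuousWithinAt_update hsel h hGs hG (hFG hw.1) hw.2
  have hmaps : Set.MapsTo (update M sel) Z Z := by
    intro w hw
    -- The update maps the orbit into itself, and continuity at `w` along the orbit carries this
    -- over to its closure.
    refine ⟨((hcont w hw).mono horb).mem_closure hw.1 ?_, update_mem_sigmaZero hsel h hw.2⟩
    rintro _ ⟨t, rfl⟩
    exact ⟨t + 1, Function.iterate_succ_apply' _ _ _⟩
  set A : Z → Z := hmaps.restrict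
  have hAcont : Continuous A := by
    have : ContinuousOn (update M sel) Z := fun w hw =>
      (hcont w hw).mono (Set.inter_subset_left.trans hFG)
    exact this.mapsToRestrict hmaps
  set V : Z → ℝ := fun w => -Real.log ((best M sel w).err w)
  have hstep : ∀ w : Z, V w ≤ potential M (A w) - potential M w + M.card * Real.log 2 := fun w =>
    neg_log_err_best_le hsel h w.2.2
  have hV0 : ∀ w, 0 ≤ V w := fun w => neg_nonneg.2 <|
    Real.log_nonpos (w.2.2.2 _ (best_mem hsel hM w)).le (err_le_one _ w.2.2.1)
  have hVc : ∀ c, IsCompact {w | V w ≤ c} := fun c => by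
    rw [Topology.IsEmbedding.subtypeVal.isCompact_iff]
    convert isCompact_inter_neg_log_err_le M hFc c using 1
    ext w
    constructor
    · rintro ⟨v, hv, rfl⟩
      exact ⟨v.2.1, (neg_log_err_best_le_iff hsel hM v.2.2 c).1 hv⟩
    · rintro ⟨hwF, hw⟩
      -- The bound `exp (-c)` is positive, so limits of points in the sublevel set cannot leave
      -- `sigmaZero M`.
      have hw0 : w ∈ sigmaZero M :=
        ⟨hGs (hFG hwF), fun η hη => (Real.exp_pos _).trans_le (hw η hη)⟩
      exact ⟨⟨w, hwF, hw0⟩, (neg_log_err_best_le_iff hsel hM hw0 c).2 hw, rfl⟩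
  let z : Z := ⟨w₀, subset_closure ⟨0, rfl⟩, hw₀'⟩
  have hsum : ∀ n, birkhoffSum A V n z
      ≤ potential M (A^[n] z) - potential M z + n * (M.card * Real.log 2) := by
    intro n
    induction n with
    | zero => simp
    | succ n ih =>
      rw [birkhoffSum_succ, Function.iterate_succ_apply']
      push_cast
      linarith [hstep (A^[n] z)]
  -- In the telescoped bound the final potential is at most 0, and the initial term `-potential M z
  -- ≥ 0` is enlarged by the factor `n + 1`.
  obtain ⟨ν, hν, hAν⟩ := exists_measurePreserving_of_birkhoffSum_le hAcont hV0 hVc z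
    (M.card * Real.log 2 - potential M z) (fun n => by
      have h1 := hsum (n + 1)
      have h2 := potential_nonpos (A^[n + 1] z).2.2
      have h3 := mul_nonneg (neg_nonneg.2 (potential_nonpos z.2.2)) (Nat.cast_nonneg (α := ℝ) n)
      push_cast at h1
      linarith)
  have hval : Measurable (Subtype.val : Z → Fin m → ℝ) := measurable_subtype_coe
  refine ⟨ν.map Subtype.val, Measure.isProbabilityMeasure_map hval.aemeasurable, ?_,
    measurable_update M sel, ?_⟩
  · exact (ae_map_iff hval.aemeasurable (measurableSet_sigmaZero M)).2 (ae_of_all _ fun w => w.2.2)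
  · rw [Measure.map_map (measurable_update M sel) hval]
    conv_rhs => rw [← hAν.map_eq, Measure.map_map hval hAν.measurable]
    rfl

end Existence

/-! ### Limits of the averaged coefficients and scores -/

section Limits

variable {m : ℕ} {M : Finset (Row m)} {sel : Finset (Row m) → Row m}

theorem rowCoeff_eq_birkhoffSum (w : Fin m → ℝ) (η : Row m) (T : ℕ) :
    rowCoeff M sel w η T = birkhoffSum (update M sel)
      (fun v => alpha M v * (sigmaStar M sel η).indicator (fun _ => (1 : ℝ)) v) T w :=
  rfl

theorem ae_exists_tendsto_rowCoeff (hsel : IsTieBreaker M sel) (h : WeakLearning M)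
    {μ : Measure (Fin m → ℝ)} (hμ : IsInvariantProbability M sel μ) (η : Row m) :
    ∀ᵐ w ∂μ, ∃ c, Tendsto (fun T : ℕ => 1 / (T : ℝ) * rowCoeff M sel w η T) atTop (𝓝 c) := by
  have _ := hμ.1
  have hind : Measurable ((sigmaStar M sel η).indicator fun _ => (1 : ℝ)) :=
    measurable_const.indicator (measurableSet_sigmaStar M sel η)
  have hint := (integrable_alpha hsel h hμ).mul_bdd (c := 1) hind.aestronglyMeasurable
    (ae_of_all _ fun w => by
      by_cases hw : w ∈ sigmaStar M sel η <;> simp [hw])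
  simp only [rowCoeff_eq_birkhoffSum]
  exact ae_exists_tendsto_birkhoff hμ.2.2 ((measurable_alpha M).mul hind) hint

/-- The regions `sigmaStar M sel η` partition the simplex, so each round is credited to exactly one
row. The instance `z` enters only through `rep η z`. -/
theorem score_eq_sum_rowCoeff {X : Type*} (hsel : IsTieBreaker M sel) (hM : M.Nonempty)
    {w : Fin m → ℝ} (hw : ∀ t, weights M sel w t ∈ stdSimplex ℝ (Fin m)) {rep : Row m → X → ℤˣ}
    {h : ℕ → X → ℤˣ} (hh : PicksRepresentatives M sel rep w h) (T : ℕ) (z : X) :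
    score M sel w h T z = ∑ η ∈ M, rowCoeff M sel w η T * ((rep η z : ℤ) : ℝ) := by
  simp only [rowCoeff, Finset.sum_mul]
  rw [Finset.sum_comm, score]
  refine Finset.sum_congr rfl fun t _ => ?_
  rw [Finset.sum_eq_single_of_mem _ (best_mem hsel hM (weights M sel w t))]
  · have : weights M sel w t ∈ sigmaStar M sel (best M sel (weights M sel w t)) := ⟨hw t, rfl⟩
    simp [this, hh t]
  · intro η _ hη
    have : weights M sel w t ∉ sigmaStar M sel η := fun hmem => hη hmem.2
    simp [this]

end Limits

end OptimalAdaBoost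
end

theorem mainTheorem4 {X : Type*} {m : ℕ} (x : Fin m → X) (y : Fin m → ℤˣ) (H : Set (X → ℤˣ))
    (M : Finset (OptimalAdaBoost.Row m)) (hM : M = OptimalAdaBoost.errMatrix x y H)
    (sel : Finset (OptimalAdaBoost.Row m) → OptimalAdaBoost.Row m)
    (hsel : OptimalAdaBoost.IsTieBreaker M sel)
    (hweak : OptimalAdaBoost.WeakLearning M)
    (hties : OptimalAdaBoost.EventuallyNoTies M sel)
    (rep : OptimalAdaBoost.Row m → X → ℤˣ)
    (hrep : ∀ η ∈ M, rep η ∈ OptimalAdaBoost.dichClass x y H η) :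
    ((OptimalAdaBoost.omegaInf M sel).Nonempty →
      ∃ μ : Measure (Fin m → ℝ), OptimalAdaBoost.IsInvariantProbability M sel μ) ∧
    ∀ μ : Measure (Fin m → ℝ), OptimalAdaBoost.IsInvariantProbability M sel μ →
      ∀ᵐ w₁ ∂μ, ∃ C : OptimalAdaBoost.Row m → ℝ,
        (∀ η ∈ M, Tendsto (fun T : ℕ => (1 / (T : ℝ)) * OptimalAdaBoost.rowCoeff M sel w₁ η T)
          atTop (𝓝 (C η))) ∧
        ∀ h : ℕ → X → ℤˣ, OptimalAdaBoost.PicksRepresentatives M sel rep w₁ h →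
          ∀ z : X, Tendsto (fun T : ℕ => (1 / (T : ℝ)) * OptimalAdaBoost.score M sel w₁ h T z)
            atTop (𝓝 (∑ η ∈ M, C η * ((rep η z : ℤ) : ℝ))) := by
  refine ⟨OptimalAdaBoost.exists_isInvariantProbability hsel hweak hties, fun μ hμ => ?_⟩
  -- There are finitely many rows, so one null set serves them all; it is fixed before `h` and the
  -- instance `z` are chosen.
  filter_upwards [hμ.2.1, ae_all_iff.2 fun η =>
    OptimalAdaBoost.ae_exists_tendsto_rowCoeff hsel hweak hμ η] with w hw hlim
  choose C hC using hlim
  refine ⟨C, fun η _ => hC η, fun h hh z => ?_⟩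
  simp only [OptimalAdaBoost.score_eq_sum_rowCoeff hsel (hweak.nonempty hw.1)
    (fun t => (OptimalAdaBoost.weights_mem_sigmaZero hsel hweak hw t).1) hh, Finset.mul_sum,
    ← mul_assoc]
  exact tendsto_finsetSum _ fun η _ => (hC η).mul_const _
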